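/- Let $V$ be a finite set, let $U=(U_i)_{i\in V}$ be a vector of random variables with joint probability distribution $p$, where each $U_i$ takes values in an arbitrary measurable space, and let $G$ be an undirected graph (without loops or multiple edges) with node set $V$. For pairwise disjoint $X,Y,Z\subseteq V$ write $X\perp_p Y\mid Z$ if $U_X=(U_i)_{i\in X}$ is conditionally independent of $U_Y$ given $U_Z$ under $p$, and write $X\perp_G Y\mid Z$ if every path in $G$ from a node in $X$ to a node in $Y$ contains some node of $V\setminus(X\cup Y\cup Z)$ (the interpretation of $G$ as a covariance graph). Suppose that $p$ is faithful to the covariance graph $G$, i.e. $X\perp_p Y\mid Z$ if and only if $X\perp_G Y\mid Z$, for all pairwise disjoint $X,Y,Z\subseteq V$. Then $p$ is a WTC graphoid, that is, for all pairwise disjoint $X,Y,Z,W\subseteq V$ the following hold (juxtaposition denotes union): - symmetry: $X\perp_p Y\mid Z\Rightarrow Y\perp_p X\mid Z$; - decomposition: $X\perp_p YW\mid Z\Rightarrow X\perp_p Y\mid Z$; - weak union: $X\perp_p YW\mid Z\Rightarrow X\perp_p Y\mid ZW$; - contraction: $X\perp_p Y\mid ZW$ and $X\perp_p W\mid Z$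 $\Rightarrow X\perp_p YW\mid Z$; - intersection: $X\perp_p Y\mid ZW$ and $X\perp_p W\mid ZY$ $\Rightarrow X\perp_p YW\mid Z$; - weak transitivity: $X\perp_p Y\mid Z$ and $X\perp_p Y\mid Z\cup\{K\}$ $\Rightarrow X\perp_p \{K\}\mid Z$ or $\{K\}\perp_p Y\mid Z$, for every $K\in V\setminus(X\cup Y\cup Z)$; - composition: $X\perp_p Y\mid Z$ and $X\perp_p W\mid Z$ $\Rightarrow X\perp_p YW\mid Z$. -/

import Mathlib

open MeasureTheory

namespace CovGraph

section Distributions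

/-- The σ-algebra generated by the subvector `U_I = (U_i)_{i ∈ I}` of the coordinate vector
`U = (U_i)_{i ∈ V}` on the joint sample space `∏ i, S i`. -/
abbrev subvectorSigma {V : Type*} (S : V → Type*) [∀ i, MeasurableSpace (S i)] (I : Set V) :
    MeasurableSpace (∀ i, S i) :=
  MeasurableSpace.comap (fun (u : ∀ i, S i) (i : I) => u i) MeasurableSpace.pi

theorem subvectorSigma_le {V : Type*} (S : V → Type*) [∀ i, MeasurableSpace (S i)] (I : Set V) :
    subvectorSigma S I ≤ MeasurableSpace.pi :=
  Measurable.comap_le (measurable_pi_lambda _ fun i => measurable_pi_apply (i : V))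

/-- Conditional independence of `U_X` and `U_Y` given `U_Z` under the joint distribution `p`:
`P(A ∩ B | U_Z) = P(A | U_Z) P(B | U_Z)` almost surely for all events `A` determined by `U_X` and
`B` determined by `U_Y`. No regular conditional distribution, hence no standard Borel assumption,
is needed for this form. -/
def CondIndep {V : Type*} {S : V → Type*} [∀ i, MeasurableSpace (S i)]
    (p : Measure (∀ i, S i)) (X Y Z : Set V) : Prop :=
  ∀ A B : Set (∀ i, S i),
    MeasurableSet[subvectorSigma S X] A → MeasurableSet[subvectorSigma S Y] B →
      p[(A ∩ B).indicator (fun _ => (1 : ℝ)) | subvectorSigma S Z]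
        =ᵐ[p] p[A.indicator (fun _ => (1 : ℝ)) | subvectorSigma S Z]
          * p[B.indicator (fun _ => (1 : ℝ)) | subvectorSigma S Z]

end Distributions

section Disjointness

/-- `X`, `Y`, `Z` are (pairwise) disjoint. -/
def Disjoint3 {V : Type*} (X Y Z : Set V) : Prop :=
  Disjoint X Y ∧ Disjoint X Z ∧ Disjoint Y Z

/-- `X`, `Y`, `Z`, `W` are (pairwise) disjoint. -/
def Disjoint4 {V : Type*} (X Y Z W : Set V) : Prop :=
  Disjoint3 X Y Z ∧ Disjoint X W ∧ Disjoint Y W ∧ Disjoint Z W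

end Disjointness

section Graphoids

/-- The distribution `p` is a graphoid. -/
structure IsGraphoid {V : Type*} {S : V → Type*} [∀ i, MeasurableSpace (S i)]
    (p : Measure (∀ i, S i)) : Prop where
  symmetry : ∀ X Y Z : Set V, Disjoint3 X Y Z → CondIndep p X Y Z → CondIndep p Y X Z
  decomposition : ∀ X Y Z W : Set V, Disjoint4 X Y Z W →
    CondIndep p X (Y ∪ W) Z → CondIndep p X Y Z
  weak_union : ∀ X Y Z W : Set V, Disjoint4 X Y Z W →
    CondIndep p X (Y ∪ W) Z → CondIndep p X Y (Z ∪ W)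
  contraction : ∀ X Y Z W : Set V, Disjoint4 X Y Z W →
    CondIndep p X Y (Z ∪ W) → CondIndep p X W Z → CondIndep p X (Y ∪ W) Z
  intersection : ∀ X Y Z W : Set V, Disjoint4 X Y Z W →
    CondIndep p X Y (Z ∪ W) → CondIndep p X W (Z ∪ Y) → CondIndep p X (Y ∪ W) Z

/-- The distribution `p` is a WTC graphoid: a graphoid that also satisfies weak transitivity
and composition. -/
structure IsWTCGraphoid {V : Type*} {S : V → Type*} [∀ i, MeasurableSpace (S i)]
    (p : Measure (∀ i, S i)) : Prop extends IsGraphoid p where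
  weak_transitivity : ∀ (X Y Z : Set V) (K : V), Disjoint3 X Y Z → K ∉ X ∪ Y ∪ Z →
    CondIndep p X Y Z → CondIndep p X Y (Z ∪ {K}) → CondIndep p X {K} Z ∨ CondIndep p {K} Y Z
  composition : ∀ X Y Z W : Set V, Disjoint4 X Y Z W →
    CondIndep p X Y Z → CondIndep p X W Z → CondIndep p X (Y ∪ W) Z

end Graphoids

section Graphs

/-- Separation in an undirected graph: every path from a node in `X` to a node in `Y` has some
node in `Z`. -/
def Sep {V : Type*} (G : SimpleGraph V) (X Y Z : Set V) : Prop :=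
  ∀ a ∈ X, ∀ b ∈ Y, ∀ w : G.Walk a b, w.IsPath → ∃ c ∈ w.support, c ∈ Z

/-- The independence statements represented by `G` interpreted as a covariance graph: `X` is
separated from `Y` given `V \ (X ∪ Y ∪ Z)`. -/
def CovIndep {V : Type*} (G : SimpleGraph V) (X Y Z : Set V) : Prop :=
  Sep G X Y (Set.univ \ (X ∪ Y ∪ Z))

/-- The distribution `p` is faithful to the covariance graph `G`. -/
def Faithful {V : Type*} {S : V → Type*} [∀ i, MeasurableSpace (S i)]
    (p : Measure (∀ i, S i)) (G : SimpleGraph V) : Prop :=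
  ∀ X Y Z : Set V, Disjoint3 X Y Z → (CondIndep p X Y Z ↔ CovIndep G X Y Z)

end Graphs

end CovGraph

/-! Faithfulness turns each property of `p` into the same property of `CovIndep`, so the argument is
purely graph-theoretic. By `covIndep_iff_walk`, independence means that no walk from `X` to `Y`
stays in the region `X ∪ Y ∪ Z`. Walks may be reversed, cut and appended freely, and each axiom
compares the regions and endpoints involved. Composition rests on cutting a walk at its first node
in `Y ∪ W` (`exists_walk_to_first_mem`). -/

namespace CovGraph

/-- Covariance separation fails exactly when some walk from `X` to `Y` stays in `X ∪ Y ∪ Z`. -/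
theorem covIndep_iff_walk {V : Type*} {G : SimpleGraph V} {X Y Z : Set V} :
    CovIndep G X Y Z ↔
      ∀ a ∈ X, ∀ b ∈ Y, ∀ w : G.Walk a b, ¬ ∀ c ∈ w.support, c ∈ X ∪ Y ∪ Z := by
  classical
  constructor
  · intro h a ha b hb w hw
    obtain ⟨c, hc, hc'⟩ := h a ha b hb w.bypass w.bypass_isPath
    exact hc'.2 (hw c (w.support_bypass_subset_support hc))
  · intro h a ha b hb w _
    have h' := h a ha b hb w
    push Not at h'
    obtain ⟨c, hc, hc'⟩ := h'
    exact ⟨c, hc, Set.mem_univ c, hc'⟩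

/-- A walk ending in `T` has an initial segment that meets `T` only at its last node. -/
theorem exists_walk_to_first_mem {V : Type*} {G : SimpleGraph V} {T : Set V} {a b : V}
    (w : G.Walk a b) (hb : b ∈ T) :
    ∃ c ∈ T, ∃ q : G.Walk a c, q.support ⊆ w.support ∧ ∀ x ∈ q.support, x ∈ T → x = c := by
  induction w with
  | nil => exact ⟨_, hb, .nil, fun _ h => h, by simp⟩
  | @cons u v _ h p ih =>
    by_cases hu : u ∈ T
    · exact ⟨u, hu, .nil, by simp, by simp⟩
    · obtain ⟨c, hc, q, hq, hq'⟩ := ih hb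
      refine ⟨c, hc, .cons h q, ?_, ?_⟩
      · rw [SimpleGraph.Walk.support_cons, SimpleGraph.Walk.support_cons]
        exact List.cons_subset_cons u hq
      · intro x hx hxT
        rw [SimpleGraph.Walk.support_cons, List.mem_cons] at hx
        rcases hx with rfl | hx
        · exact absurd hxT hu
        · exact hq' x hx hxT

namespace CovIndep

variable {V : Type*} {G : SimpleGraph V} {X Y Z W : Set V}

theorem symm (h : CovIndep G X Y Z) : CovIndep G Y X Z := by
  rw [covIndep_iff_walk] at *
  intro a ha b hb w hw
  refine h b hb a ha w.reverse fun c hc => ?_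
  rw [SimpleGraph.Walk.support_reverse, List.mem_reverse] at hc
  rw [Set.union_comm X Y]
  exact hw c hc

theorem decomposition (h : CovIndep G X (Y ∪ W) Z) : CovIndep G X Y Z := by
  rw [covIndep_iff_walk] at *
  intro a ha b hb w hw
  refine h a ha b (.inl hb) w fun c hc => ?_
  have := hw c hc
  simp only [Set.mem_union] at *
  tauto

/-- Both sides allow the same region `X ∪ Y ∪ Z ∪ W`; only the set of possible endpoints shrinks. -/
theorem weak_union (h : CovIndep G X (Y ∪ W) Z) : CovIndep G X Y (Z ∪ W) := by
  rw [covIndep_iff_walk] at *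
  intro a ha b hb w hw
  refine h a ha b (.inl hb) w fun c hc => ?_
  have := hw c hc
  simp only [Set.mem_union] at *
  tauto

theorem contraction (h₁ : CovIndep G X Y (Z ∪ W)) (h₂ : CovIndep G X W Z) :
    CovIndep G X (Y ∪ W) Z := by
  classical
  rw [covIndep_iff_walk] at *
  intro a ha b hb w hw
  -- The region of `h₁` is all of `X ∪ Y ∪ Z ∪ W`, so a walk meeting `Y` could be cut there to
  -- contradict `h₁`. Hence `w` avoids `Y` and fits the smaller region of `h₂`.
  have key : ∀ y ∈ Y, y ∉ w.support := by
    intro y hy hyw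
    refine h₁ a ha y hy (w.takeUntil y hyw) fun c hc => ?_
    have := hw c (w.support_takeUntil_subset_support hyw hc)
    simp only [Set.mem_union] at *
    tauto
  have hbW : b ∈ W := hb.resolve_left fun hbY => key b hbY w.end_mem_support
  refine h₂ a ha b hbW w fun c hc => ?_
  have h := hw c hc
  have hcY : c ∉ Y := fun hcY => key c hcY hc
  simp only [Set.mem_union] at *
  tauto

/-- All three statements share one region; the hypotheses split the endpoint between `Y` and `W`. -/
theorem intersection (h₁ : CovIndep G X Y (Z ∪ W)) (h₂ : CovIndep G X W (Z ∪ Y)) :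
    CovIndep G X (Y ∪ W) Z := by
  rw [covIndep_iff_walk] at *
  intro a ha b hb w hw
  rcases hb with hb | hb
  · refine h₁ a ha b hb w fun c hc => ?_
    have := hw c hc
    simp only [Set.mem_union] at *
    tauto
  · refine h₂ a ha b hb w fun c hc => ?_
    have := hw c hc
    simp only [Set.mem_union] at *
    tauto

theorem composition (h₁ : CovIndep G X Y Z) (h₂ : CovIndep G X W Z) :
    CovIndep G X (Y ∪ W) Z := by
  rw [covIndep_iff_walk] at *
  intro a ha b hb w hw
  -- Before `c` the walk `q` avoids both `Y` and `W`, so it fits the region of whichever hypothesis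
  -- concerns the set containing `c`.
  obtain ⟨c, hc, q, hq, hqc⟩ := exists_walk_to_first_mem w hb
  have hsupp : ∀ x ∈ q.support, x ∈ X ∨ x ∈ Z ∨ x = c := by
    intro x hx
    rcases hw x (hq hx) with (h | h) | h
    · exact .inl h
    · exact .inr (.inr (hqc x hx h))
    · exact .inr (.inl h)
  rcases hc with hc | hc
  · refine h₁ a ha c hc q fun x hx => ?_
    rcases hsupp x hx with h | h | rfl
    exacts [.inl (.inl h), .inr h, .inl (.inr hc)]
  · refine h₂ a ha c hc q fun x hx => ?_
    rcases hsupp x hx with h | h | rfl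
    exacts [.inl (.inl h), .inr h, .inl (.inr hc)]

/-- Two walks, from `X` to `K` and from `K` to `Y`, concatenate to one from `X` to `Y`. -/
theorem weak_transitivity {K : V} (h : CovIndep G X Y (Z ∪ {K})) :
    CovIndep G X {K} Z ∨ CovIndep G {K} Y Z := by
  simp only [covIndep_iff_walk] at *
  by_contra! hcon
  obtain ⟨⟨a, ha, k, hk, w, hw⟩, k', hk', b, hb, w', hw'⟩ := hcon
  obtain rfl : k = K := hk
  obtain rfl : k' = k := hk'
  refine h a ha b hb (w.append w') fun c hc => ?_
  rw [SimpleGraph.Walk.mem_support_append_iff] at hc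
  rcases hc with hc | hc
  · have := hw c hc
    simp only [Set.mem_union] at *
    tauto
  · have := hw' c hc
    simp only [Set.mem_union] at *
    tauto

end CovIndep

theorem Disjoint3.symm {V : Type*} {X Y Z : Set V} (h : Disjoint3 X Y Z) : Disjoint3 Y X Z :=
  ⟨h.1.symm, h.2.2, h.2.1⟩

namespace Disjoint4

variable {V : Type*} {X Y Z W : Set V}

/-- Faithfulness applies only to disjoint triples, and some hypotheses have `W` in the place of `Y`.
-/
theorem swap (h : Disjoint4 X Y Z W) : Disjoint4 X W Z Y :=
  ⟨⟨h.2.1, h.1.2.1, h.2.2.2.symm⟩, h.1.1, h.2.2.1.symm, h.1.2.2.symm⟩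

theorem union_middle (h : Disjoint4 X Y Z W) : Disjoint3 X (Y ∪ W) Z :=
  ⟨h.1.1.union_right h.2.1, h.1.2.1, h.1.2.2.union_left h.2.2.2.symm⟩

theorem union_right (h : Disjoint4 X Y Z W) : Disjoint3 X Y (Z ∪ W) :=
  ⟨h.1.1, h.1.2.1.union_right h.2.1, h.1.2.2.union_right h.2.2.1⟩

end Disjoint4

end CovGraph

theorem theorem4 {V : Type*} [Finite V] (G : SimpleGraph V)
    (S : V → Type*) [∀ i, MeasurableSpace (S i)]
    (p : Measure (∀ i, S i)) [IsProbabilityMeasure p]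
    (hp : CovGraph.Faithful p G) :
    CovGraph.IsWTCGraphoid p := by
  refine { symmetry := ?_, decomposition := ?_, weak_union := ?_, contraction := ?_,
           intersection := ?_, weak_transitivity := ?_, composition := ?_ }
  · intro X Y Z d h
    exact (hp _ _ _ d.symm).2 ((hp _ _ _ d).1 h).symm
  · intro X Y Z W d h
    exact (hp _ _ _ d.1).2 ((hp _ _ _ d.union_middle).1 h).decomposition
  · intro X Y Z W d h
    exact (hp _ _ _ d.union_right).2 ((hp _ _ _ d.union_middle).1 h).weak_union
  · intro X Y Z W d h₁ h₂
    exact (hp _ _ _ d.union_middle).2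
      (((hp _ _ _ d.union_right).1 h₁).contraction ((hp _ _ _ d.swap.1).1 h₂))
  · intro X Y Z W d h₁ h₂
    exact (hp _ _ _ d.union_middle).2
      (((hp _ _ _ d.union_right).1 h₁).intersection ((hp _ _ _ d.swap.union_right).1 h₂))
  · intro X Y Z K d hK _ h₂
    have hXK : K ∉ X := fun h => hK (.inl (.inl h))
    have hYK : K ∉ Y := fun h => hK (.inl (.inr h))
    have hZK : K ∉ Z := fun h => hK (.inr h)
    have dZ : CovGraph.Disjoint3 X Y (Z ∪ {K}) :=
      ⟨d.1, d.2.1.union_right (Set.disjoint_singleton_right.2 hXK),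
        d.2.2.union_right (Set.disjoint_singleton_right.2 hYK)⟩
    have dX : CovGraph.Disjoint3 X {K} Z :=
      ⟨Set.disjoint_singleton_right.2 hXK, d.2.1, Set.disjoint_singleton_left.2 hZK⟩
    have dY : CovGraph.Disjoint3 {K} Y Z :=
      ⟨Set.disjoint_singleton_left.2 hYK, Set.disjoint_singleton_left.2 hZK, d.2.2⟩
    exact ((hp _ _ _ dZ).1 h₂).weak_transitivity.imp (hp _ _ _ dX).2 (hp _ _ _ dY).2
  · intro X Y Z W d h₁ h₂
    exact (hp _ _ _ d.union_middle).2
      (((hp _ _ _ d.1).1 h₁).composition ((hp _ _ _ d.swap.1).1 h₂))
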